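/- Let $n,m\in\mathbb{R}$. For a positive function $\phi$ on $\mathbb{R}$ write $L_\phi u=-(\phi^n u_z)_z+\phi^m u$ (derivatives in the weak sense), and let $u=L_\phi^{-1}[-(\phi^n)_z]$ denote the solution $u\in H^1(\mathbb{R})$ of $L_\phi u=-(\phi^n)_z$. Let $H^k=W^{k,2}(\mathbb{R})$ with norm $\|f\|_{H^k}^2=\sum_{j\le k}\|\partial_z^jf\|_{L^2}^2$. For $T>0$, a local $H^k$ solution of the magma equation $$\phi_t=\phi^m u,\qquad L_\phi u=-(\phi^n)_z$$ on $[0,T]$ with data $\phi_0$ is a function $\phi(z,t)$ with $\phi>0$, $\phi(\cdot,t)-1\in H^k$ and $$\phi(\cdot,t)=\phi_0+\int_0^t\phi(\cdot,s)^m\,L_{\phi(\cdot,s)}^{-1}\bigl[-(\phi(\cdot,s)^n)_z\bigr]\,ds\qquad(0\le t\le T),$$ the integral being an $L^2(\mathbb{R})$-valued (Bochner) integral. For $R,\epsilon,T>0$ let $$\mathcal{X}^k_{R,\epsilon,T}=\Bigl\{\phi:\ \phi-1\in C^1([0,T],H^k(\mathbb{R})),\ \sup_{0\le t<T}\|\phi(\cdot,t)-1\|_{H^k}\le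 R,\ \sup_{0\le t<T}\|\phi(\cdot,t)^{-1}\|_\infty\le\epsilon^{-1}\Bigr\}.$$ **Theorem.** Let $k\ge1$ be an integer, $R>0$ and $0<\epsilon\le1$. There is a constant $C=C(R,\epsilon,k,n,m)$ such that the following holds. Let $\phi_0$ and $\psi_0$ satisfy $$\|\phi_0-1\|_{H^k}<R,\quad \|1/\phi_0\|_\infty\le\tfrac1{2\epsilon},\qquad \|\psi_0-1\|_{H^k}<R,\quad \|1/\psi_0\|_\infty\le\tfrac1{2\epsilon},$$ let $T>0$, and let $\phi,\psi\in\mathcal{X}^k_{R,\epsilon,T}$ be local $H^k$ solutions on $[0,T]$ with data $\phi_0$ and $\psi_0$ respectively. Then $$\|\phi(\cdot,t)-\psi(\cdot,t)\|_{H^k}\le\|\phi_0-\psi_0\|_{H^k}\,e^{Ct}\qquad\text{for all }0\le t<T.$$ -/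

import Mathlib

open MeasureTheory Set
open scoped ENNReal ContDiff

noncomputable section

namespace Magma

/-- `g` is the weak derivative of `f` on the real line. -/
def IsWeakDeriv (f g : ℝ → ℝ) : Prop :=
  LocallyIntegrable f volume ∧ LocallyIntegrable g volume ∧
    ∀ η : ℝ → ℝ, ContDiff ℝ ∞ η → HasCompactSupport η →
      ∫ z, f z * deriv η z = -∫ z, g z * η z

theorem IsWeakDeriv.congr {f g f' g' : ℝ → ℝ} (h : IsWeakDeriv f g)
    (hf : f =ᵐ[volume] f') (hg : g =ᵐ[volume] g') : IsWeakDeriv f' g' := by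
  obtain ⟨h1, h2, h3⟩ := h
  refine ⟨(locallyIntegrable_congr hf).1 h1, (locallyIntegrable_congr hg).1 h2, ?_⟩
  intro η hη hc
  have e1 : ∫ z, f' z * deriv η z = ∫ z, f z * deriv η z :=
    integral_congr_ae (by filter_upwards [hf] with z hz; rw [hz])
  have e2 : ∫ z, g' z * η z = ∫ z, g z * η z :=
    integral_congr_ae (by filter_upwards [hg] with z hz; rw [hz])
  rw [e1, e2, h3 η hη hc]

theorem integrable_mul_test {f η : ℝ → ℝ} (hf : LocallyIntegrable f volume)
    (hη : Continuous η) (hc : HasCompactSupport η) : Integrable (fun z => f z * η z) volume := by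
  simpa [smul_eq_mul, mul_comm] using hf.integrable_smul_left_of_hasCompactSupport hη hc

theorem IsWeakDeriv.add {f g f' g' : ℝ → ℝ} (h : IsWeakDeriv f g) (h' : IsWeakDeriv f' g') :
    IsWeakDeriv (f + f') (g + g') := by
  refine ⟨h.1.add h'.1, h.2.1.add h'.2.1, ?_⟩
  intro η hη hc
  have hd : Continuous (deriv η) := hη.continuous_deriv (by simp)
  simp only [Pi.add_apply, add_mul]
  rw [integral_add (integrable_mul_test h.1 hd hc.deriv) (integrable_mul_test h'.1 hd hc.deriv),
    integral_add (integrable_mul_test h.2.1 hη.continuous hc)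
      (integrable_mul_test h'.2.1 hη.continuous hc), h.2.2 η hη hc, h'.2.2 η hη hc]
  ring

theorem IsWeakDeriv.smul {f g : ℝ → ℝ} (c : ℝ) (h : IsWeakDeriv f g) :
    IsWeakDeriv (c • f) (c • g) := by
  refine ⟨h.1.smul c, h.2.1.smul c, ?_⟩
  intro η hη hc
  simp only [Pi.smul_apply, smul_eq_mul, mul_assoc, integral_const_mul]
  rw [h.2.2 η hη hc]
  ring

theorem isWeakDeriv_zero : IsWeakDeriv 0 0 :=
  ⟨locallyIntegrable_zero, locallyIntegrable_zero, by intro η _ _; simp⟩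

/-- The real Lebesgue space `L²(ℝ)`. -/
abbrev L2 : Type := Lp ℝ 2 (volume : Measure ℝ)

/-- The Sobolev space `H^k(ℝ) = W^{k,2}(ℝ)`. A function is stored together with its weak
derivatives of order `0, …, k`, all in `L²`; these are determined by the function. The norm is
the usual one, `‖p‖² = ∑_{j ≤ k} ‖∂_z^j p‖²_{L²}`. -/
def Hk (k : ℕ) : Submodule ℝ (PiLp 2 (fun _ : Fin (k + 1) => L2)) where
  carrier := {p | ∀ j : Fin k, IsWeakDeriv (p j.castSucc) (p j.succ)}
  add_mem' := by
    intro p q hp hq j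
    exact ((hp j).add (hq j)).congr (Lp.coeFn_add _ _).symm (Lp.coeFn_add _ _).symm
  zero_mem' := by
    intro j
    exact isWeakDeriv_zero.congr (Lp.coeFn_zero ℝ 2 volume).symm (Lp.coeFn_zero ℝ 2 volume).symm
  smul_mem' := by
    intro c p hp j
    exact ((hp j).smul c).congr (Lp.coeFn_smul _ _).symm (Lp.coeFn_smul _ _).symm

/-- The function of `z` underlying an element of `H^k(ℝ)`. -/
def toFn {k : ℕ} (p : Hk k) : ℝ → ℝ := (p.1 0 : L2)

/-- The function `f` belongs to `H^k(ℝ)`. -/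
def MemHk (k : ℕ) (f : ℝ → ℝ) : Prop := ∃ p : Hk k, f =ᵐ[volume] toFn p

/-- The `H^k` norm of a function, equal to `∞` when the function is not in `H^k(ℝ)`. -/
def hkNorm (k : ℕ) (f : ℝ → ℝ) : ℝ≥0∞ := ⨅ (p : Hk k) (_ : f =ᵐ[volume] toFn p), ‖p‖ₑ

/-- `‖1 / f‖_∞`, with `1 / 0 = ∞`. -/
def invSupNorm (f : ℝ → ℝ) : ℝ≥0∞ := essSup (fun z => ‖f z‖ₑ⁻¹) volume

/-- `f ∈ C¹([0,T], H^k(ℝ))`. -/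
def IsC1Hk (k : ℕ) (T : ℝ) (f : ℝ → ℝ → ℝ) : Prop :=
  ∃ p : ℝ → Hk k, ContDiffOn ℝ 1 p (Icc 0 T) ∧ ∀ t ∈ Icc 0 T, f t =ᵐ[volume] toFn (p t)

/-- The set `X^k_{R,ε,T}`; `φ t z` is the value at time `t` and position `z`. -/
def X (k : ℕ) (R ε T : ℝ) : Set (ℝ → ℝ → ℝ) :=
  {φ | IsC1Hk k T (fun t z => φ t z - 1) ∧
    (⨆ t ∈ Ico 0 T, hkNorm k (fun z => φ t z - 1)) ≤ ENNReal.ofReal R ∧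
    (⨆ t ∈ Ico 0 T, invSupNorm (φ t)) ≤ ENNReal.ofReal ε⁻¹}

/-- `L_φ u = f`, where `L_φ u = -(φ^n u_z)_z + φ^m u` with weak derivatives. -/
def EllipticEq (n m : ℝ) (φ u f : ℝ → ℝ) : Prop :=
  ∃ v w : ℝ → ℝ, IsWeakDeriv u v ∧ IsWeakDeriv (fun z => φ z ^ n * v z) w ∧
    ∀ᵐ z, -w z + φ z ^ m * u z = f z

/-- `u = L_φ⁻¹[-(φ^n)_z]`: `u` is the solution in `H¹(ℝ)` of `L_φ u = -(φ^n)_z`. -/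
def IsVelocity (n m : ℝ) (φ u : ℝ → ℝ) : Prop :=
  MemHk 1 u ∧ ∃ g : ℝ → ℝ, IsWeakDeriv (fun z => φ z ^ n) g ∧
    EllipticEq n m φ u (fun z => -g z)

/-- `Φ = Λ[φ]` on `[0,T]`, where `Λ[φ](t) = φ₀ + ∫₀ᵗ φ^m L_φ⁻¹[-(φ^n)_z] ds`. The time integral is
the `L²(ℝ)`-valued Bochner integral of `q s = φ(s)^m u(s)`. -/
def IsLambda (n m T : ℝ) (φ₀ : ℝ → ℝ) (φ Φ : ℝ → ℝ → ℝ) : Prop :=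
  ∃ (u : ℝ → ℝ → ℝ) (q : ℝ → L2),
    (∀ s ∈ Icc 0 T, IsVelocity n m (φ s) (u s)) ∧
    (∀ s ∈ Icc 0 T, q s =ᵐ[volume] fun z => φ s z ^ m * u s z) ∧
    IntervalIntegrable q volume 0 T ∧
    ∀ t ∈ Icc 0 T, Φ t =ᵐ[volume] fun z => φ₀ z + (∫ s in (0 : ℝ)..t, q s : L2) z

/-- `φ` is a local `H^k` solution with data `φ₀` on the time interval `[0,T]`. -/
structure IsLocalSolution (n m : ℝ) (k : ℕ) (T : ℝ) (φ₀ : ℝ → ℝ) (φ : ℝ → ℝ → ℝ) : Prop where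
  pos : ∀ t ∈ Icc 0 T, ∀ᵐ z, 0 < φ t z
  mem : ∀ t ∈ Icc 0 T, MemHk k (fun z => φ t z - 1)
  fixed : IsLambda n m T φ₀ φ φ

end Magma

end

/-! The magma equation is treated as an ordinary differential equation `φ_t = N(φ)` in `1 + H^k`,
with `N(φ) = φ^m L_φ⁻¹[-(φ^n)_z]`. If `N` is Lipschitz in the `H^k` norm on functions with `‖φ - 1‖
≤ R` and `φ ≥ ε`, Grönwall's inequality gives the theorem.

For the Lipschitz bound, put `y = φ^n u_z - (φ^n - 1)`. The elliptic equation becomes `u' = φ^{-n} y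
+ (1 - φ^{-n})`, `y' = φ^m u`, in which no derivative falls on `φ`. Integrating `(u y)' = φ^{-n} y²
+ φ^m u² + …` over the line controls `u` and `y` in `L²`; the system itself then gains one
derivative at a time (`exists_system_bound`). The differences of the pairs `(u, y)` for two
functions `φ` and `ψ` solve a system of the same type, forced by differences of powers. These are
controlled because real powers are Lipschitz on the set (`exists_rpow_sub_bound`) and `H^k`, `k ≥
1`, is an algebra; `exists_flux_lipschitz` combines the two.

The solution is only given in integrated form in `L²`. Lebesgue differentiation recovers the
equation for almost every time, which suffices since the curves are `C¹` in `H^k`. -/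

noncomputable section

namespace Magma

open Filter Topology
open scoped NNReal

/-! ### Calculus of locally absolutely continuous functions -/

/-- `F` is locally absolutely continuous on the line, with almost everywhere derivative `f`. -/
structure HasACDeriv (F f : ℝ → ℝ) : Prop where
  ac : ∀ a b, AbsolutelyContinuousOnInterval F a b
  deriv : ∀ᵐ x, HasDerivAt F (f x) x

namespace HasACDeriv

variable {F f G g : ℝ → ℝ}

theorem continuous (h : HasACDeriv F f) : Continuous F := by
  refine continuous_iff_continuousAt.2 fun x => ?_
  have h1 := (h.ac (x - 1) (x + 1)).continuousOn
  refine h1.continuousAt ?_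
  rw [uIcc_of_le (by linarith)]
  exact Icc_mem_nhds (by linarith) (by linarith)

theorem ae_eq_deriv (h : HasACDeriv F f) : f =ᵐ[volume] _root_.deriv F := by
  filter_upwards [h.deriv] with x hx
  exact hx.deriv.symm

theorem intervalIntegrable (h : HasACDeriv F f) (a b : ℝ) : IntervalIntegrable f volume a b :=
  (h.ac a b).intervalIntegrable_deriv.congr_ae (ae_restrict_of_ae h.ae_eq_deriv.symm)

theorem integral_eq_sub (h : HasACDeriv F f) (a b : ℝ) : ∫ x in a..b, f x = F b - F a := by
  rw [← (h.ac a b).integral_deriv_eq_sub]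
  refine intervalIntegral.integral_congr_ae ?_
  filter_upwards [h.ae_eq_deriv] with x hx _ using hx

theorem locallyIntegrable (h : HasACDeriv F f) : LocallyIntegrable f volume := by
  intro x
  refine ⟨Icc (x - 1) (x + 1), Icc_mem_nhds (by linarith) (by linarith), ?_⟩
  exact (intervalIntegrable_iff_integrableOn_Icc_of_le (by linarith)).1 (h.intervalIntegrable _ _)

theorem mul (hF : HasACDeriv F f) (hG : HasACDeriv G g) :
    HasACDeriv (fun x => F x * G x) (fun x => f x * G x + F x * g x) := by
  refine ⟨fun a b => (hF.ac a b).mul (hG.ac a b), ?_⟩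
  filter_upwards [hF.deriv, hG.deriv] with x h1 h2 using h1.mul h2

theorem of_contDiff {η : ℝ → ℝ} (hη : ContDiff ℝ 1 η) : HasACDeriv η (_root_.deriv η) :=
  ⟨fun _ _ => hη.contDiffOn.absolutelyContinuousOnInterval,
    .of_forall fun x => (hη.differentiable (by simp) x).hasDerivAt⟩

theorem isWeakDeriv (h : HasACDeriv F f) : IsWeakDeriv F f := by
  refine ⟨h.continuous.locallyIntegrable, h.locallyIntegrable, fun η hη hc => ?_⟩
  have hη1 : ContDiff ℝ 1 η := hη.of_le (by exact_mod_cast le_top)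
  have hm := h.mul (of_contDiff hη1)
  obtain ⟨r, hr⟩ := hc.isCompact.isBounded.subset_closedBall 0
  rw [Real.closedBall_eq_Icc] at hr
  set s := max r 0 with hs
  have hsub : tsupport η ⊆ Ioo (-(s + 1)) (s + 1) := by
    intro x hx
    have := hr hx
    constructor <;> linarith [this.1, this.2, le_max_left r 0]
  have e := hm.integral_eq_sub (-(s + 1)) (s + 1)
  have z1 : η (s + 1) = 0 := image_eq_zero_of_notMem_tsupport fun hx => by
    have := (hsub hx).2; linarith
  have z2 : η (-(s + 1)) = 0 := image_eq_zero_of_notMem_tsupport fun hx => by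
    have := (hsub hx).1; linarith
  have hi1 : Integrable (fun x => f x * η x) volume :=
    integrable_mul_test h.locallyIntegrable hη.continuous hc
  have hi2 : Integrable (fun x => F x * _root_.deriv η x) volume :=
    integrable_mul_test h.continuous.locallyIntegrable (hη1.continuous_deriv le_rfl) hc.deriv
  rw [z1, z2, intervalIntegral.integral_eq_integral_of_support_subset, integral_add hi1 hi2] at e
  · linarith
  · intro x hx
    refine Ioo_subset_Ioc_self (hsub ?_)
    by_contra hn
    refine hx ?_
    have hn' : x ∉ tsupport (_root_.deriv η) := fun hh => hn (tsupport_deriv_subset hh)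
    simp [image_eq_zero_of_notMem_tsupport hn, image_eq_zero_of_notMem_tsupport hn']

/-- The derivative of an integrable absolutely continuous function has integral zero. -/
theorem integral_eq_zero (h : HasACDeriv F f) (hF : Integrable F volume)
    (hf : Integrable f volume) : ∫ x, f x = 0 := by
  -- Integrability of `f` gives `F` limits at both ends, and integrability of `F` forces them to
  -- vanish.
  have htop : Tendsto F atTop (𝓝 (F 0 + ∫ x in Ioi 0, f x)) := by
    have := (intervalIntegral_tendsto_integral_Ioi 0 hf.integrableOn tendsto_id).const_add (F 0)
    refine this.congr fun x => ?_
    rw [id, h.integral_eq_sub]; ring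
  have hbot : Tendsto F atBot (𝓝 (F 0 - ∫ x in Iic 0, f x)) := by
    have := (intervalIntegral_tendsto_integral_Iic 0 hf.integrableOn tendsto_id).const_sub (F 0)
    refine this.congr fun x => ?_
    rw [id, h.integral_eq_sub]; ring
  have e1 := (hF.integrableAtFilter atTop).eq_zero_of_tendsto
    (fun s hs => by
      obtain ⟨a, ha⟩ := mem_atTop_sets.1 hs
      exact top_le_iff.1 (Real.volume_Ici (a := a) ▸ measure_mono ha)) htop
  have e2 := (hF.integrableAtFilter atBot).eq_zero_of_tendsto
    (fun s hs => by
      obtain ⟨a, ha⟩ := mem_atBot_sets.1 hs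
      exact top_le_iff.1 (Real.volume_Iic (a := a) ▸ measure_mono ha)) hbot
  rw [← intervalIntegral.integral_Iic_add_Ioi hf.integrableOn hf.integrableOn (b := 0)]
  linarith

/-- On a bounded interval `F` takes values in some `[ε, M]`, where the power is Lipschitz; a
Lipschitz map preserves absolute continuity. -/
theorem rpow {ε : ℝ} (h : HasACDeriv F f) (hε : 0 < ε) (hF : ∀ x, ε ≤ F x) (s : ℝ) :
    HasACDeriv (fun x => F x ^ s) (fun x => s * F x ^ (s - 1) * f x) := by
  refine ⟨fun a b => ?_, ?_⟩
  · obtain ⟨M, hM⟩ := (h.ac a b).exists_bound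
    have hcd : ContDiffOn ℝ 1 (fun y : ℝ => y ^ s) (Icc ε M) := fun y hy =>
      (Real.contDiffAt_rpow_const_of_ne (by linarith [hy.1])).contDiffWithinAt
    obtain ⟨K, hK⟩ := hcd.exists_lipschitzOnWith (by simp) (convex_Icc _ _) isCompact_Icc
    have hac := h.ac a b
    have hm : ∀ x ∈ uIcc a b, F x ∈ Icc ε M := fun x hx =>
      ⟨hF x, (le_abs_self _).trans (hM x hx)⟩
    unfold AbsolutelyContinuousOnInterval at hac ⊢
    refine squeeze_zero' (.of_forall fun E => Finset.sum_nonneg fun i _ => dist_nonneg) ?_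
      (by simpa using hac.const_mul (K : ℝ))
    refine mem_inf_of_right ?_
    rintro ⟨N, I⟩ hE
    simp only [Finset.mul_sum, Set.mem_ofPred_eq]
    refine Finset.sum_le_sum fun i hi => ?_
    exact hK.dist_le_mul _ (hm _ (hE.1 i hi).1) _ (hm _ (hE.1 i hi).2)
  · filter_upwards [h.deriv] with x hx
    have := hx.rpow_const (p := s) (Or.inl (by linarith [hF x]))
    convert this using 1
    ring

end HasACDeriv

/-! ### Weak derivatives and their absolutely continuous representatives -/

/-- The primitive from the left of the support vanishes again to its right because the total
integral is zero. -/
theorem exists_antideriv_test {ξ : ℝ → ℝ} (hξ : ContDiff ℝ ∞ ξ) (hc : HasCompactSupport ξ)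
    (h0 : ∫ x, ξ x = 0) :
    ∃ η : ℝ → ℝ, ContDiff ℝ ∞ η ∧ HasCompactSupport η ∧ deriv η = ξ := by
  obtain ⟨r, hr⟩ := hc.isCompact.isBounded.subset_closedBall 0
  rw [Real.closedBall_eq_Icc] at hr
  simp only [zero_sub, zero_add] at hr
  set a := -(max r 0 + 1) with ha
  set b := max r 0 + 1 with hb
  have hab : a < b := by have := le_max_right r 0; rw [ha]; linarith
  have hsub : ∀ x, x ∉ Ioo a b → ξ x = 0 := fun x hx => by
    refine image_eq_zero_of_notMem_tsupport fun hx' => hx ?_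
    have := hr hx'
    constructor <;> linarith [this.1, this.2, le_max_left r 0]
  have hd : ∀ x, HasDerivAt (fun x => ∫ t in a..x, ξ t) (ξ x) x := fun x =>
    intervalIntegral.integral_hasDerivAt_right (hξ.continuous.intervalIntegrable _ _)
      (hξ.continuous.stronglyMeasurableAtFilter _ _) hξ.continuous.continuousAt
  have hde : deriv (fun x => ∫ t in a..x, ξ t) = ξ := funext fun x => (hd x).deriv
  refine ⟨fun x => ∫ t in a..x, ξ t, ?_, ?_, hde⟩
  · rw [contDiff_infty_iff_deriv, hde]
    exact ⟨fun x => (hd x).differentiableAt, hξ⟩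
  · refine HasCompactSupport.intro (isCompact_Icc (a := a) (b := b)) fun x hx => ?_
    rcases not_and_or.1 hx with h | h
    · rw [not_le] at h
      rw [intervalIntegral.integral_symm, intervalIntegral.integral_of_le h.le, neg_eq_zero]
      refine setIntegral_eq_zero_of_forall_eq_zero fun t ht => hsub t fun h' => ?_
      linarith [h'.1, ht.2]
    · rw [not_le] at h
      rw [intervalIntegral.integral_eq_integral_of_support_subset, h0]
      intro t ht
      by_contra hn
      refine ht (hsub t fun h' => hn ⟨h'.1, by linarith [h'.2]⟩)

/-- The lemma of du Bois-Reymond. -/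
theorem IsWeakDeriv.ae_eq_const {h : ℝ → ℝ} (hw : IsWeakDeriv h 0) :
    ∃ c : ℝ, h =ᵐ[volume] fun _ => c := by
  let ρ : ContDiffBump (0 : ℝ) := ⟨1, 2, one_pos, one_lt_two⟩
  have ρs : ContDiff ℝ ∞ (ρ.normed volume) := ρ.contDiff_normed
  have ρc : HasCompactSupport (ρ.normed volume) := ρ.hasCompactSupport_normed
  have ρi : ∫ x, ρ.normed volume x = 1 := ρ.integral_normed
  refine ⟨∫ x, h x * ρ.normed volume x, ?_⟩
  refine ae_eq_of_integral_contDiff_smul_eq hw.1 continuous_const.locallyIntegrable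
    fun θ hθ hθc => ?_
  have hθi : Integrable θ volume := hθ.continuous.integrable_of_hasCompactSupport hθc
  have hρi : Integrable (ρ.normed volume) volume := ρs.continuous.integrable_of_hasCompactSupport ρc
  -- Subtracting a multiple of a unit-mass bump gives the test function mean zero, so that it is
  -- itself the derivative of a test function.
  obtain ⟨η, h1, h2, h3⟩ := exists_antideriv_test
    (ξ := fun x => θ x - (∫ y, θ y) * ρ.normed volume x)
    (hθ.sub (contDiff_const.mul ρs)) (by
      have := hθc.sub (ρc.mul_left (f := fun _ : ℝ => ∫ y, θ y))
      exact this) (by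
      rw [integral_sub hθi (hρi.const_mul _), integral_const_mul, ρi]; ring)
  have := hw.2.2 η h1 h2
  rw [h3] at this
  simp only [Pi.zero_apply, zero_mul, integral_zero, neg_zero, mul_sub] at this
  have i1 := integrable_mul_test hw.1 hθ.continuous hθc
  have i2 := integrable_mul_test hw.1 ρs.continuous ρc
  have e : ∀ x, h x * ((∫ y, θ y) * ρ.normed volume x) =
      (∫ y, θ y) * (h x * ρ.normed volume x) := fun x => by ring
  simp only [e] at this
  rw [integral_sub i1 (i2.const_mul _), integral_const_mul] at this
  simp only [smul_eq_mul, integral_mul_const]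
  simp only [mul_comm (θ _)]
  linarith

theorem IsWeakDeriv.neg {f g : ℝ → ℝ} (h : IsWeakDeriv f g) :
    IsWeakDeriv (fun x => -f x) (fun x => -g x) := by
  have := h.smul (-1)
  refine this.congr (.of_forall fun x => ?_) (.of_forall fun x => ?_) <;> simp

theorem IsWeakDeriv.sub {f g f' g' : ℝ → ℝ} (h : IsWeakDeriv f g) (h' : IsWeakDeriv f' g') :
    IsWeakDeriv (fun x => f x - f' x) (fun x => g x - g' x) := by
  refine (h.add h'.neg).congr (.of_forall fun x => ?_) (.of_forall fun x => ?_) <;>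
    simp [sub_eq_add_neg]

theorem IsWeakDeriv.unique {f g g' : ℝ → ℝ} (h : IsWeakDeriv f g) (h' : IsWeakDeriv f g') :
    g =ᵐ[volume] g' := by
  refine ae_eq_of_integral_contDiff_smul_eq h.2.1 h'.2.1 fun θ hθ hθc => ?_
  have := (h.2.2 θ hθ hθc).symm.trans (h'.2.2 θ hθ hθc)
  simpa [mul_comm] using this

theorem hasACDeriv_integral {g : ℝ → ℝ} (hg : LocallyIntegrable g volume) :
    HasACDeriv (fun x => ∫ t in (0 : ℝ)..x, g t) g := by
  have hi : ∀ x y, IntervalIntegrable g volume x y := fun x y =>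
    (intervalIntegrable_iff.2 <| (hg.integrableOn_isCompact isCompact_uIcc).mono_set
      uIoc_subset_uIcc)
  refine ⟨fun a b => ?_, ?_⟩
  · have hab : min (min a b) 0 ≤ max (max a b) 0 := (min_le_right _ _).trans (le_max_right _ _)
    have h' := (hi (min (min a b) 0)
      (max (max a b) 0)).absolutelyContinuousOnInterval_intervalIntegral (c := 0) (by
        rw [uIcc_of_le hab]
        exact ⟨min_le_right _ _, le_max_right _ _⟩)
    refine h'.mono ?_
    rw [uIcc_of_le hab]
    exact Icc_subset_Icc (min_le_left _ _) (le_max_left _ _)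
  · filter_upwards [_root_.LocallyIntegrable.ae_hasDerivAt_integral hg] with x hx using hx 0

theorem HasACDeriv.add_const {F f : ℝ → ℝ} (h : HasACDeriv F f) (c : ℝ) :
    HasACDeriv (fun x => F x + c) f := by
  refine ⟨fun a b => (h.ac a b).fun_add ?_, ?_⟩
  · exact (contDiffOn_const (c := c)).absolutelyContinuousOnInterval
  · filter_upwards [h.deriv] with x hx using hx.add_const c

/-- A weakly differentiable function has a locally absolutely continuous representative. -/
theorem IsWeakDeriv.exists_hasACDeriv {f g : ℝ → ℝ} (h : IsWeakDeriv f g) :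
    ∃ F : ℝ → ℝ, f =ᵐ[volume] F ∧ HasACDeriv F g := by
  have hG := hasACDeriv_integral h.2.1
  have hz : IsWeakDeriv (fun x => f x - ∫ t in (0 : ℝ)..x, g t) 0 :=
    (h.sub hG.isWeakDeriv).congr .rfl (.of_forall fun x => by simp)
  obtain ⟨c, hc⟩ := hz.ae_eq_const
  refine ⟨_, ?_, hG.add_const c⟩
  filter_upwards [hc] with x hx
  linarith

theorem isWeakDeriv_const (c : ℝ) : IsWeakDeriv (fun _ => c) 0 := by
  refine HasACDeriv.isWeakDeriv ⟨fun a b => ?_, .of_forall fun x => hasDerivAt_const x c⟩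
  exact (contDiffOn_const (c := c)).absolutelyContinuousOnInterval

theorem IsWeakDeriv.mul {f f' g g' : ℝ → ℝ} (hf : IsWeakDeriv f f') (hg : IsWeakDeriv g g') :
    IsWeakDeriv (fun x => f x * g x) (fun x => f' x * g x + f x * g' x) := by
  obtain ⟨F, eF, hF⟩ := hf.exists_hasACDeriv
  obtain ⟨G, eG, hG⟩ := hg.exists_hasACDeriv
  refine (hF.mul hG).isWeakDeriv.congr ?_ ?_ <;>
  · filter_upwards [eF, eG] with x h1 h2
    simp [h1, h2]

theorem IsWeakDeriv.integral_eq_zero {f g : ℝ → ℝ} (h : IsWeakDeriv f g)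
    (hf : Integrable f volume) (hg : Integrable g volume) : ∫ x, g x = 0 := by
  obtain ⟨F, eF, hF⟩ := h.exists_hasACDeriv
  exact hF.integral_eq_zero (hf.congr eF) hg

theorem IsWeakDeriv.rpow {f g : ℝ → ℝ} {ε : ℝ} (h : IsWeakDeriv f g) (hε : 0 < ε)
    (hf : ∀ᵐ x, ε ≤ f x) (s : ℝ) :
    IsWeakDeriv (fun x => f x ^ s) (fun x => s * f x ^ (s - 1) * g x) := by
  obtain ⟨F, eF, hF⟩ := h.exists_hasACDeriv
  have hge : ∀ x, ε ≤ F x := by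
    -- Two continuous functions equal almost everywhere are equal, so the almost everywhere bound on
    -- `f` holds everywhere for `F`.
    have h1 : (fun x => max ε (F x)) =ᵐ[volume] F := by
      filter_upwards [eF, hf] with x h1 h2
      rw [← h1]; exact max_eq_right h2
    have h2 := Measure.eq_of_ae_eq h1 (continuous_const.max hF.continuous) hF.continuous
    intro x
    rw [← congrFun h2 x]; exact le_max_left _ _
  refine (hF.rpow hε hge s).isWeakDeriv.congr ?_ ?_ <;>
  · filter_upwards [eF] with x h1
    simp [h1]

/-- The one-dimensional Sobolev embedding. -/
theorem IsWeakDeriv.ae_abs_le {f g : ℝ → ℝ} {B : ℝ≥0} (h : IsWeakDeriv f g)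
    (hf : eLpNorm f 2 volume ≤ B) (hg : eLpNorm g 2 volume ≤ B) : ∀ᵐ x, |f x| ≤ 2 * B := by
  obtain ⟨F, eF, hF⟩ := h.exists_hasACDeriv
  have key : ∀ x, |F x| ≤ 2 * B := by
    intro x
    -- `|F x| ≤ |F y| + ∫ |g|` is averaged over `y` in a unit interval, where the `L¹` norm is at
    -- most the `L²` norm; each term contributes one `B`.
    set μ : Measure ℝ := volume.restrict (Ioc x (x + 1)) with hμ
    have : IsProbabilityMeasure μ := ⟨by simp [hμ]⟩
    have l1 : ∀ w : ℝ → ℝ, AEStronglyMeasurable w volume → eLpNorm w 2 volume ≤ B →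
        eLpNorm w 1 μ ≤ B := fun w hw hB =>
      (eLpNorm_le_eLpNorm_of_exponent_le (by norm_num) hw.restrict).trans
        ((eLpNorm_mono_measure _ Measure.restrict_le_self).trans hB)
    have hFm := hF.continuous.aestronglyMeasurable (μ := (volume : Measure ℝ))
    have b1 := l1 F hFm (by rwa [← eLpNorm_congr_ae eF])
    have b2 := l1 g h.2.1.aestronglyMeasurable hg
    have conv : ∀ w : ℝ → ℝ, AEStronglyMeasurable w volume → eLpNorm w 1 μ ≤ B →
        Integrable w μ ∧ ∫ y, |w y| ∂μ ≤ B := fun w hw hB => by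
      have hm : MemLp w 1 μ := ⟨hw.restrict, hB.trans_lt ENNReal.coe_lt_top⟩
      have hi := memLp_one_iff_integrable.1 hm
      refine ⟨hi, ?_⟩
      have := integral_norm_eq_lintegral_enorm (μ := μ) (f := w) hw.restrict
      simp only [Real.norm_eq_abs] at this
      rw [this, ← eLpNorm_one_eq_lintegral_enorm]
      exact ENNReal.toReal_le_coe_of_le_coe hB
    obtain ⟨i1, c1⟩ := conv F hFm b1
    obtain ⟨i2, c2⟩ := conv g h.2.1.aestronglyMeasurable b2
    have hle : ∀ᵐ y ∂μ, |F x| ≤ |F y| + ∫ y, |g y| ∂μ := by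
      refine (ae_restrict_iff' measurableSet_Ioc).2 (.of_forall fun y hy => ?_)
      have e := hF.integral_eq_sub x y
      have b : |∫ t in x..y, g t| ≤ ∫ t, |g t| ∂μ := by
        rw [intervalIntegral.integral_of_le hy.1.le]
        refine abs_integral_le_integral_abs.trans ?_
        refine setIntegral_mono_set i2.abs (.of_forall fun _ => abs_nonneg _)
          (.of_forall fun t ht => ⟨ht.1, ht.2.trans hy.2⟩)
      have : F x = F y - ∫ t in x..y, g t := by rw [e]; ring
      calc |F x| = |F y - ∫ t in x..y, g t| := by rw [← this]
        _ ≤ |F y| + |∫ t in x..y, g t| := abs_sub _ _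
        _ ≤ _ := by linarith
    have := integral_mono_ae (integrable_const _) (i1.abs.add (integrable_const _)) hle
    simp only [integral_const, probReal_univ, one_smul, Pi.add_apply] at this
    rw [integral_add i1.abs (integrable_const _)] at this
    simp only [integral_const, probReal_univ, one_smul] at this
    linarith
  filter_upwards [eF] with x hx
  rw [hx]; exact key x

/-! ### Quantitative Sobolev bounds and products -/

/-- `f` lies in `H^k(ℝ)` and each of its weak derivatives of order `0, …, k` has `L²` norm at
most `B`. -/
def SobBound : ℕ → (ℝ → ℝ) → ℝ≥0 → Prop
  | 0, f, B => AEStronglyMeasurable f volume ∧ eLpNorm f 2 volume ≤ B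
  | k + 1, f, B => (AEStronglyMeasurable f volume ∧ eLpNorm f 2 volume ≤ B) ∧
      ∃ g, IsWeakDeriv f g ∧ SobBound k g B

namespace SobBound

variable {k : ℕ} {f g : ℝ → ℝ} {A B : ℝ≥0}

theorem zero_order (h : SobBound k f B) : SobBound 0 f B := by
  cases k with
  | zero => exact h
  | succ k => exact h.1

theorem memLp (h : SobBound k f B) : MemLp f 2 volume :=
  ⟨h.zero_order.1, h.zero_order.2.trans_lt ENNReal.coe_lt_top⟩

theorem of_succ (h : SobBound (k + 1) f B) : SobBound k f B := by
  induction k generalizing f with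
  | zero => exact h.1
  | succ k ih =>
    obtain ⟨h0, g, hg, hB⟩ := h
    exact ⟨h0, g, hg, ih hB⟩

theorem of_le {j : ℕ} (h : SobBound k f B) (hj : j ≤ k) : SobBound j f B := by
  induction hj with
  | refl => exact h
  | step _ ih => exact ih h.of_succ

theorem mono (h : SobBound k f A) (hAB : A ≤ B) : SobBound k f B := by
  induction k generalizing f with
  | zero => exact ⟨h.1, h.2.trans (by exact_mod_cast hAB)⟩
  | succ k ih =>
    obtain ⟨h0, g, hg, hB⟩ := h
    exact ⟨⟨h0.1, h0.2.trans (by exact_mod_cast hAB)⟩, g, hg, ih hB⟩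

theorem congr (h : SobBound k f B) (hfg : f =ᵐ[volume] g) : SobBound k g B := by
  cases k with
  | zero => exact ⟨h.1.congr hfg, by rw [← eLpNorm_congr_ae hfg]; exact h.2⟩
  | succ k =>
    obtain ⟨h0, g', hg, hB⟩ := h
    exact ⟨⟨h0.1.congr hfg, by rw [← eLpNorm_congr_ae hfg]; exact h0.2⟩, g',
      hg.congr hfg .rfl, hB⟩

theorem of_weakDeriv (h : SobBound (k + 1) f B) (hg : IsWeakDeriv f g) : SobBound k g B := by
  obtain ⟨_, g', hg', hB⟩ := h
  exact hB.congr (hg'.unique hg)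

theorem succ (h0 : SobBound 0 f B) (hg : IsWeakDeriv f g) (h : SobBound k g B) :
    SobBound (k + 1) f B :=
  ⟨h0, g, hg, h⟩

theorem add (hf : SobBound k f A) (hg : SobBound k g B) :
    SobBound k (fun x => f x + g x) (A + B) := by
  have z : ∀ {f g : ℝ → ℝ}, SobBound 0 f A → SobBound 0 g B →
      SobBound 0 (fun x => f x + g x) (A + B) := fun hf hg =>
    ⟨hf.1.add hg.1, (eLpNorm_add_le hf.1 hg.1 (by norm_num)).trans (by
      push_cast; exact add_le_add hf.2 hg.2)⟩
  induction k generalizing f g with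
  | zero => exact z hf hg
  | succ k ih =>
    obtain ⟨hf0, f', hf', hA⟩ := hf
    obtain ⟨hg0, g', hg', hB⟩ := hg
    exact ⟨z hf0 hg0, _, hf'.add hg', ih hA hB⟩

theorem const_mul (c : ℝ) (hf : SobBound k f B) :
    SobBound k (fun x => c * f x) (‖c‖₊ * B) := by
  have z : ∀ {f : ℝ → ℝ}, SobBound 0 f B →
      SobBound 0 (fun x => c * f x) (‖c‖₊ * B) := fun {f} hf =>
    ⟨hf.1.const_mul c, by
      refine (eLpNorm_const_smul_le (c := c) (f := f) (p := 2) (μ := volume)).trans ?_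
      push_cast
      exact mul_le_mul_right hf.2 _⟩
  induction k generalizing f with
  | zero => exact z hf
  | succ k ih =>
    obtain ⟨hf0, f', hf', hA⟩ := hf
    exact ⟨z hf0, _, hf'.smul c, ih hA⟩

theorem neg (hf : SobBound k f B) : SobBound k (fun x => -f x) B := by
  simpa using hf.const_mul (-1)

theorem sub (hf : SobBound k f A) (hg : SobBound k g B) :
    SobBound k (fun x => f x - g x) (A + B) := by
  simpa [sub_eq_add_neg] using hf.add hg.neg

theorem zero_fun : SobBound k (fun _ => 0) B := by
  induction k with
  | zero => exact ⟨aestronglyMeasurable_const, by simp⟩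
  | succ k ih => exact ⟨⟨aestronglyMeasurable_const, by simp⟩, _, isWeakDeriv_const 0, ih⟩

theorem ae_abs_le (h : SobBound (k + 1) f B) : ∀ᵐ x, |f x| ≤ (2 * B : ℝ≥0) := by
  obtain ⟨h0, g, hg, hB⟩ := h
  exact_mod_cast hg.ae_abs_le h0.2 hB.zero_order.2

theorem bdd_mul (hf : ∀ᵐ x, |f x| ≤ A) (hfm : AEStronglyMeasurable f volume)
    (hg : SobBound 0 g B) : SobBound 0 (fun x => f x * g x) (A * B) := by
  refine ⟨hfm.mul hg.1, ?_⟩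
  have := eLpNorm_le_nnreal_smul_eLpNorm_of_ae_le_mul (p := 2) (μ := volume) (c := A)
    (f := fun x => f x * g x) (g := g) (by
      filter_upwards [hf] with x hx
      have h2 : ‖f x‖₊ ≤ A := by exact_mod_cast hx
      rw [nnnorm_mul]
      exact mul_le_mul_left h2 _)
  refine this.trans ?_
  rw [ENNReal.smul_def, smul_eq_mul]
  push_cast
  exact mul_le_mul_right hg.2 _

/-- Multiplication is bounded from `H^{k+1} × H^k` to `H^k`. -/
theorem mul_of_succ (hf : SobBound (k + 1) f A) (hg : SobBound k g B) :
    SobBound k (fun x => f x * g x) (2 ^ (k + 1) * A * B) := by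
  induction k generalizing f g with
  | zero => simpa using bdd_mul hf.ae_abs_le hf.memLp.1 hg
  | succ k ih =>
    obtain ⟨hf0, f', hf', hA⟩ := hf
    obtain ⟨hg0, g', hg', hB⟩ := hg
    refine succ (mono (bdd_mul (SobBound.ae_abs_le ⟨hf0, f', hf', hA⟩) hf0.1 hg0) ?_)
      (hf'.mul hg') ?_
    · gcongr
      exact le_self_pow₀ one_le_two (by omega)
    -- In `f' g` the second factor gives up a derivative, in `f g'` the first does; both products
    -- fall under the induction hypothesis.
    · refine mono (((ih (f := f') (g := g) hA (of_succ ⟨hg0, g', hg', hB⟩))).add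
        (ih (of_succ ⟨hf0, f', hf', hA⟩) hB)) (le_of_eq ?_)
      ring

/-- `H^{k+1}` is an algebra. -/
theorem mul (hf : SobBound (k + 1) f A) (hg : SobBound (k + 1) g B) :
    SobBound (k + 1) (fun x => f x * g x) (2 ^ (k + 2) * A * B) := by
  obtain ⟨f', hf', hA⟩ := hf.2
  obtain ⟨g', hg', hB⟩ := hg.2
  refine succ (mono (bdd_mul hf.ae_abs_le hf.memLp.1 hg.zero_order) ?_) (hf'.mul hg') ?_
  · gcongr
    exact le_self_pow₀ one_le_two (by omega)
  · refine mono (add (congr (hg.mul_of_succ hA) (.of_forall fun x => mul_comm _ _))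
      (hf.mul_of_succ hB)) (le_of_eq ?_)
    ring

end SobBound

/-! ### Real powers on `1 + H^{k+1}` -/

theorem exists_rpow_bounds {ε : ℝ} (hε : 0 < ε) (M s : ℝ) :
    ∃ L P : ℝ≥0, (∀ x ∈ Icc ε M, |x ^ s| ≤ P) ∧
      ∀ x ∈ Icc ε M, ∀ y ∈ Icc ε M, |x ^ s - y ^ s| ≤ L * |x - y| := by
  have hcd : ContDiffOn ℝ 1 (fun y : ℝ => y ^ s) (Icc ε M) := fun y hy =>
    (Real.contDiffAt_rpow_const_of_ne (by linarith [hy.1])).contDiffWithinAt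
  obtain ⟨L, hL⟩ := hcd.exists_lipschitzOnWith (by simp) (convex_Icc _ _) isCompact_Icc
  obtain ⟨P, hP⟩ := isCompact_Icc.exists_bound_of_continuousOn hcd.continuousOn
  exact ⟨L, P.toNNReal, fun x hx => (hP x hx).trans (Real.le_coe_toNNReal P),
    fun x hx y hy => hL.dist_le_mul x hx y hy⟩

theorem SobBound.ae_mem_Icc {k : ℕ} {φ : ℝ → ℝ} {K : ℝ≥0} {ε : ℝ}
    (h : SobBound (k + 1) (fun x => φ x - 1) K) (hε : ∀ᵐ x, ε ≤ φ x) :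
    ∀ᵐ x, φ x ∈ Icc ε (1 + 2 * K) := by
  filter_upwards [h.ae_abs_le, hε] with x h1 h2
  refine ⟨h2, ?_⟩
  have := (le_abs_self _).trans h1
  push_cast at this
  linarith

theorem SobBound.exists_weakDeriv {k : ℕ} {φ : ℝ → ℝ} {K : ℝ≥0}
    (h : SobBound (k + 1) (fun x => φ x - 1) K) :
    ∃ φ', IsWeakDeriv φ φ' ∧ SobBound k φ' K := by
  obtain ⟨φ', hφ', hK⟩ := h.2
  refine ⟨φ', (hφ'.add (isWeakDeriv_const 1)).congr (.of_forall fun x => ?_)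
    (.of_forall fun x => ?_), hK⟩ <;> simp

/-- Real powers are Lipschitz on bounded subsets of `1 + H^{k+1}` that are bounded away from
zero. -/
theorem exists_rpow_sub_bound (k : ℕ) (K : ℝ≥0) {ε : ℝ} (hε : 0 < ε) (hε1 : ε ≤ 1) (s : ℝ) :
    ∃ C : ℝ≥0, ∀ (φ ψ : ℝ → ℝ) (B : ℝ≥0), SobBound (k + 1) (fun x => φ x - 1) K →
      SobBound (k + 1) (fun x => ψ x - 1) K → (∀ᵐ x, ε ≤ φ x) → (∀ᵐ x, ε ≤ ψ x) →
      SobBound (k + 1) (fun x => φ x - ψ x) B →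
      SobBound (k + 1) (fun x => φ x ^ s - ψ x ^ s) (C * B) := by
  have base : ∀ s : ℝ, ∃ L P : ℝ≥0, ∀ (k : ℕ) (φ ψ : ℝ → ℝ) (B : ℝ≥0),
      SobBound (k + 1) (fun x => φ x - 1) K → SobBound (k + 1) (fun x => ψ x - 1) K →
      (∀ᵐ x, ε ≤ φ x) → (∀ᵐ x, ε ≤ ψ x) → SobBound (k + 1) (fun x => φ x - ψ x) B →
      SobBound 0 (fun x => φ x ^ s - ψ x ^ s) (L * B) ∧
      (∀ᵐ x, |φ x ^ s - ψ x ^ s| ≤ (L * (2 * B) : ℝ≥0)) ∧ (∀ᵐ x, |ψ x ^ s| ≤ P) ∧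
      AEStronglyMeasurable (fun x => φ x ^ s) volume ∧
      AEStronglyMeasurable (fun x => ψ x ^ s) volume := by
    intro s
    obtain ⟨L, P, hP, hL⟩ := exists_rpow_bounds hε (1 + 2 * K) s
    refine ⟨L, P, fun k φ ψ B h1 h2 e1 e2 hB => ?_⟩
    have m : ∀ {φ : ℝ → ℝ}, SobBound (k + 1) (fun x => φ x - 1) K →
        AEStronglyMeasurable (fun x => φ x ^ s) volume := fun {φ} h => by
      have : AEMeasurable φ volume := by
        simpa using h.memLp.1.aemeasurable.add_const 1
      exact (this.pow_const s).aestronglyMeasurable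
    have hlip : ∀ᵐ x, |φ x ^ s - ψ x ^ s| ≤ L * |φ x - ψ x| := by
      filter_upwards [h1.ae_mem_Icc e1, h2.ae_mem_Icc e2] with x hx hy using hL _ hx _ hy
    refine ⟨⟨(m h1).sub (m h2), ?_⟩, ?_, ?_, m h1, m h2⟩
    · have := eLpNorm_le_nnreal_smul_eLpNorm_of_ae_le_mul (p := 2) (μ := volume) (c := L)
        (f := fun x => φ x ^ s - ψ x ^ s) (g := fun x => φ x - ψ x) (by
          filter_upwards [hlip] with x hx
          exact_mod_cast hx)
      refine this.trans ?_
      rw [ENNReal.smul_def, smul_eq_mul]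
      push_cast
      exact mul_le_mul_right hB.zero_order.2 _
    · filter_upwards [hlip, hB.ae_abs_le] with x h1 h2
      rw [NNReal.coe_mul]
      exact h1.trans (mul_le_mul_of_nonneg_left h2 L.2)
    · filter_upwards [h2.ae_mem_Icc e2] with x hx using hP _ hx
  -- Differentiating lowers the exponent to `s - 1`, so `s` must vary. The derivative is split as
  -- `s((φ^{s-1} - ψ^{s-1}) φ' + ψ^{s-1} (φ' - ψ'))`; at the bottom level `φ'` is only in `L²` and
  -- the powers are bounded in sup norm.
  induction k generalizing s with
  | zero =>
    obtain ⟨L, P, h⟩ := base s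
    obtain ⟨L', P', h'⟩ := base (s - 1)
    refine ⟨L + ‖s‖₊ * (L' * 2 * K + P'), fun φ ψ B hφ hψ e1 e2 hB => ?_⟩
    obtain ⟨φ', wφ, bφ⟩ := hφ.exists_weakDeriv
    obtain ⟨ψ', wψ, bψ⟩ := hψ.exists_weakDeriv
    obtain ⟨h1, -⟩ := h 0 φ ψ B hφ hψ e1 e2 hB
    obtain ⟨-, h2, h3, h4, h5⟩ := h' 0 φ ψ B hφ hψ e1 e2 hB
    have hd : SobBound 0 (fun x => φ' x - ψ' x) B := hB.of_weakDeriv (wφ.sub wψ)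
    refine SobBound.succ (h1.mono ?_) ((wφ.rpow hε e1 s).sub (wψ.rpow hε e2 s)) ?_
    · gcongr
      exact le_self_add
    · refine (((SobBound.bdd_mul h2 (h4.sub h5) bφ).add
        (SobBound.bdd_mul h3 h5 hd)).const_mul s).mono ?_ |>.congr (.of_forall fun x => ?_)
      · calc ‖s‖₊ * (L' * (2 * B) * K + P' * B) = (‖s‖₊ * (L' * 2 * K + P')) * B := by ring
          _ ≤ _ := by gcongr; exact le_add_self
      · ring
  | succ k ih =>
    obtain ⟨L, P, h⟩ := base s
    obtain ⟨C, hC⟩ := ih (s - 1)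
    refine ⟨L + ‖s‖₊ * (2 ^ (k + 2) * C * K + 2 ^ (k + 2) * (C * K) + 1),
      fun φ ψ B hφ hψ e1 e2 hB => ?_⟩
    obtain ⟨φ', wφ, bφ⟩ := hφ.exists_weakDeriv
    obtain ⟨ψ', wψ, bψ⟩ := hψ.exists_weakDeriv
    obtain ⟨h1, -⟩ := h (k + 1) φ ψ B hφ hψ e1 e2 hB
    have h2 := hC φ ψ B hφ.of_succ hψ.of_succ e1 e2 hB.of_succ
    -- The power `ψ^{s-1}` is not in `L²`, but `ψ^{s-1} - 1` is a Sobolev function. Comparison with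
    -- the constant `1` is allowed because `ε ≤ 1`.
    have h3 := hC ψ (fun _ => 1) K hψ.of_succ (by simpa using SobBound.zero_fun) e2
      (.of_forall fun _ => hε1) hψ.of_succ
    have hd : SobBound (k + 1) (fun x => φ' x - ψ' x) B := hB.of_weakDeriv (wφ.sub wψ)
    refine SobBound.succ (h1.mono ?_) ((wφ.rpow hε e1 s).sub (wψ.rpow hε e2 s)) ?_
    · gcongr
      exact le_self_add
    · refine ((((h2.mul bφ).add (h3.mul hd)).add hd).const_mul s).mono ?_ |>.congr
        (.of_forall fun x => ?_)
      · calc _ = (‖s‖₊ * (2 ^ (k + 2) * C * K + 2 ^ (k + 2) * (C * K) + 1)) * B := by ring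
          _ ≤ _ := by gcongr; exact le_add_self
      · simp only [Real.one_rpow]
        ring

/-! ### Estimates for the first order system -/

theorem eLpNorm_two_le_iff {f : ℝ → ℝ} (hf : MemLp f 2 volume) {B : ℝ≥0} :
    eLpNorm f 2 volume ≤ B ↔ ∫ x, f x ^ 2 ≤ (B : ℝ) ^ 2 := by
  have h0 : 0 ≤ ∫ x, f x ^ 2 := integral_nonneg fun x => sq_nonneg _
  rw [hf.eLpNorm_eq_integral_rpow_norm (by norm_num) (by norm_num)]
  have e : ∀ x, ‖f x‖ ^ (2 : ℝ≥0∞).toReal = f x ^ 2 := fun x => by simp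
  simp only [e]
  rw [← ENNReal.ofReal_coe_nnreal, ENNReal.ofReal_le_ofReal_iff B.coe_nonneg]
  simp only [ENNReal.toReal_ofNat]
  rw [← one_div, ← Real.sqrt_eq_rpow]
  exact Real.sqrt_le_left B.coe_nonneg

/-- The energy estimate for the first order system `u' = a y + f`, `y' = c u + g`. -/
theorem system_energy_bound {δ B A : ℝ≥0} {a c f g u y : ℝ → ℝ} (hδ : 0 < δ)
    (ha : ∀ᵐ x, δ ≤ a x) (hc : ∀ᵐ x, δ ≤ c x) (haA : ∀ᵐ x, |a x| ≤ A) (hcA : ∀ᵐ x, |c x| ≤ A)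
    (ham : AEStronglyMeasurable a volume) (hcm : AEStronglyMeasurable c volume)
    (hf : SobBound 0 f B) (hg : SobBound 0 g B) (hu : MemLp u 2 volume) (hy : MemLp y 2 volume)
    (wu : IsWeakDeriv u fun x => a x * y x + f x) (wy : IsWeakDeriv y fun x => c x * u x + g x) :
    SobBound 0 u (2 / δ * B) ∧ SobBound 0 y (2 / δ * B) := by
  have hδ' : (0 : ℝ) < δ := hδ
  have L2 : ∀ {w : ℝ → ℝ}, MemLp w 2 volume → Integrable (fun x => w x ^ 2) volume :=
    fun hw => hw.integrable_sq
  have bm : ∀ {b w : ℝ → ℝ}, (∀ᵐ x, |b x| ≤ A) → AEStronglyMeasurable b volume →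
      MemLp w 2 volume → MemLp (fun x => b x * w x) 2 volume := fun {b w} hb hbm hw =>
    (SobBound.bdd_mul (B := (eLpNorm w 2 volume).toNNReal) hb hbm
      ⟨hw.1, by rw [ENNReal.coe_toNNReal hw.eLpNorm_ne_top]⟩).memLp
  have mu' := (bm haA ham hy).add hf.memLp
  have my' := (bm hcA hcm hu).add hg.memLp
  have i1 : Integrable (fun x => (a x * y x + f x) * y x) volume := mu'.integrable_mul hy
  have i2 : Integrable (fun x => u x * (c x * u x + g x)) volume := hu.integrable_mul my'
  -- The integral of `(u y)' = a y² + c u² + f y + g u` vanishes; the quadratic part is coercive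
  -- since `a, c ≥ δ`, and Young's inequality absorbs the rest.
  have e0 := (wu.mul wy).integral_eq_zero (hu.integrable_mul hy) (i1.add i2)
  have iy := L2 hy
  have iu := L2 hu
  have jf := L2 hf.memLp
  have jg := L2 hg.memLp
  have iyu : Integrable (fun x => y x ^ 2 + u x ^ 2) volume := iy.add iu
  have jfg : Integrable (fun x => f x ^ 2 + g x ^ 2) volume := jf.add jg
  have hle : ∫ x, (δ / 2 * (y x ^ 2 + u x ^ 2) - 1 / (2 * δ) * (f x ^ 2 + g x ^ 2)) ≤
      ∫ x, ((a x * y x + f x) * y x + u x * (c x * u x + g x)) := by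
    refine integral_mono_ae ((iyu.const_mul _).sub (jfg.const_mul _))
      (i1.add i2) ?_
    filter_upwards [ha, hc] with x h1 h2
    have young : ∀ p q b : ℝ, (δ : ℝ) ≤ b → δ / 2 * p ^ 2 - 1 / (2 * δ) * q ^ 2 ≤
        b * p ^ 2 + q * p := fun p q b hb => by
      have : δ / 2 * p ^ 2 + 1 / (2 * δ) * q ^ 2 + q * p = (δ * p + q) ^ 2 / (2 * δ) := by
        field_simp; ring
      have h3 : 0 ≤ (δ * p + q) ^ 2 / (2 * δ : ℝ) := by positivity
      nlinarith [sq_nonneg p]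
    have := young (y x) (f x) (a x) h1
    have := young (u x) (g x) (c x) h2
    linarith
  rw [e0, integral_sub (iyu.const_mul _) (jfg.const_mul _), integral_const_mul,
    integral_const_mul, integral_add iy iu, integral_add jf jg] at hle
  have bf := (eLpNorm_two_le_iff hf.memLp).1 hf.2
  have bg := (eLpNorm_two_le_iff hg.memLp).1 hg.2
  have p1 : 0 ≤ ∫ x, y x ^ 2 := integral_nonneg fun x => sq_nonneg _
  have p2 : 0 ≤ ∫ x, u x ^ 2 := integral_nonneg fun x => sq_nonneg _
  have tot : (∫ x, y x ^ 2) + ∫ x, u x ^ 2 ≤ ((2 / δ * B : ℝ≥0) : ℝ) ^ 2 := by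
    have h1 : δ / 2 * ((∫ x, y x ^ 2) + ∫ x, u x ^ 2) ≤ 1 / (2 * δ) * (2 * (B : ℝ) ^ 2) := by
      have : 1 / (2 * δ : ℝ) * ((∫ x, f x ^ 2) + ∫ x, g x ^ 2) ≤
          1 / (2 * δ) * (2 * (B : ℝ) ^ 2) := by gcongr; linarith
      linarith
    have h2 : (∫ x, y x ^ 2) + ∫ x, u x ^ 2 ≤ 2 * (B : ℝ) ^ 2 / δ ^ 2 := by
      rw [le_div_iff₀ (by positivity)]
      have := mul_le_mul_of_nonneg_left h1 (show (0 : ℝ) ≤ 2 * δ by positivity)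
      field_simp at this
      nlinarith
    refine h2.trans ?_
    push_cast
    rw [mul_pow, div_pow, div_mul_eq_mul_div]
    gcongr
    norm_num
  exact ⟨⟨hu.1, (eLpNorm_two_le_iff hu).2 (by linarith)⟩,
    ⟨hy.1, (eLpNorm_two_le_iff hy).2 (by linarith)⟩⟩

/-- `H^{k+1}` estimate for the first order system `u' = a y + f`, `y' = c u + g`. -/
theorem exists_system_bound (k : ℕ) (K : ℝ≥0) {δ : ℝ≥0} (hδ : 0 < δ) :
    ∃ C : ℝ≥0, ∀ (a c f g u y : ℝ → ℝ) (B : ℝ≥0), SobBound (k + 1) (fun x => a x - 1) K →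
      SobBound (k + 1) (fun x => c x - 1) K → (∀ᵐ x, δ ≤ a x) → (∀ᵐ x, δ ≤ c x) →
      SobBound (k + 1) f B → SobBound (k + 1) g B → MemLp u 2 volume → MemLp y 2 volume →
      IsWeakDeriv u (fun x => a x * y x + f x) → IsWeakDeriv y (fun x => c x * u x + g x) →
      SobBound (k + 1) u (C * B) ∧ SobBound (k + 1) y (C * B) := by
  -- Only the order of the conclusion is raised. A bound on `u, y` in `H^j` bounds the right-hand
  -- sides of the system in `H^j`, hence `u, y` in `H^{j+1}`.
  suffices H : ∀ j ≤ k + 1, ∃ C : ℝ≥0, ∀ (a c f g u y : ℝ → ℝ) (B : ℝ≥0),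
      SobBound (k + 1) (fun x => a x - 1) K →
      SobBound (k + 1) (fun x => c x - 1) K → (∀ᵐ x, δ ≤ a x) → (∀ᵐ x, δ ≤ c x) →
      SobBound (k + 1) f B → SobBound (k + 1) g B → MemLp u 2 volume → MemLp y 2 volume →
      IsWeakDeriv u (fun x => a x * y x + f x) → IsWeakDeriv y (fun x => c x * u x + g x) →
      SobBound j u (C * B) ∧ SobBound j y (C * B) from H _ le_rfl
  intro j
  induction j with
  | zero =>
    refine fun _ => ⟨2 / δ, fun a c f g u y B ha hc da dc hf hg hu hy wu wy => ?_⟩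
    have bd : ∀ {b : ℝ → ℝ}, SobBound (k + 1) (fun x => b x - 1) K →
        (∀ᵐ x, |b x| ≤ (1 + 2 * K : ℝ≥0)) ∧ AEStronglyMeasurable b volume := fun {b} hb => by
      constructor
      · filter_upwards [hb.ae_abs_le] with x hx
        have := abs_add_le (b x - 1) 1
        rw [sub_add_cancel, abs_one] at this
        push_cast at hx ⊢
        linarith
      · have : AEMeasurable b volume := by simpa using hb.memLp.1.aemeasurable.add_const 1
        exact this.aestronglyMeasurable
    exact system_energy_bound hδ da dc (bd ha).1 (bd hc).1 (bd ha).2 (bd hc).2 hf.zero_order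
      hg.zero_order hu hy wu wy
  | succ j ih =>
    intro hj
    obtain ⟨C, hC⟩ := ih (by omega)
    refine ⟨C + (2 ^ (j + 1) * K * C + C + 1),
      fun a c f g u y B ha hc da dc hf hg hu hy wu wy => ?_⟩
    obtain ⟨bu, bY⟩ := hC a c f g u y B ha hc da dc hf hg hu hy wu wy
    have rhs : ∀ {b w h : ℝ → ℝ}, SobBound (k + 1) (fun x => b x - 1) K →
        SobBound j w (C * B) → SobBound (k + 1) h B →
        SobBound j (fun x => b x * w x + h x)
          ((C + (2 ^ (j + 1) * K * C + C + 1)) * B) := fun {b w h} hb hw hh => by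
      refine (((((hb.of_le hj).mul_of_succ hw).add hw).add (hh.of_le (by omega))).mono ?_).congr
        (.of_forall fun x => ?_)
      · calc _ = (2 ^ (j + 1) * K * C + C + 1) * B := by ring
          _ ≤ _ := by gcongr ?_ * _; exact le_add_self
      · ring
    have hle : C * B ≤ (C + (2 ^ (j + 1) * K * C + C + 1)) * B := by
      gcongr; exact le_self_add
    exact ⟨(bu.zero_order.mono hle).succ wu (rhs ha bY hf),
      (bY.zero_order.mono hle).succ wy (rhs hc bu hg)⟩

/-- Inverts an upper bound for `x^{-s}`; adding `1` keeps the bound positive before inversion. -/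
theorem exists_rpow_lower_bound {ε : ℝ} (hε : 0 < ε) (M s : ℝ) :
    ∃ δ : ℝ≥0, 0 < δ ∧ ∀ x ∈ Icc ε M, δ ≤ x ^ s := by
  obtain ⟨-, P, hP, -⟩ := exists_rpow_bounds hε M (-s)
  refine ⟨(P + 1)⁻¹, by positivity, fun x hx => ?_⟩
  have hx0 : 0 < x := hε.trans_le hx.1
  have h1 : x ^ (-s) ≤ P + 1 := by linarith [(le_abs_self _).trans (hP x hx)]
  rw [Real.rpow_neg hx0.le] at h1
  push_cast
  exact inv_le_of_inv_le₀ (Real.rpow_pos_of_pos hx0 s) h1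

/-! ### Reduction of the elliptic equation and Lipschitz bound for the flux -/

/-- The velocity `u` and the flux potential `y = φ^n u_z - (φ^n - 1)` solve a first order
system. -/
theorem IsVelocity.exists_system {n m ε : ℝ} {φ u : ℝ → ℝ} {k : ℕ} {K : ℝ≥0} (hε : 0 < ε)
    (hε1 : ε ≤ 1) (hφ : SobBound (k + 1) (fun x => φ x - 1) K) (hle : ∀ᵐ x, ε ≤ φ x)
    (h : IsVelocity n m φ u) :
    ∃ y : ℝ → ℝ, MemLp u 2 volume ∧ MemLp y 2 volume ∧
      IsWeakDeriv u (fun x => φ x ^ (-n) * y x + (1 - φ x ^ (-n))) ∧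
      IsWeakDeriv y (fun x => φ x ^ m * u x) := by
  obtain ⟨⟨p, hp⟩, g, hg, v, w, hv, hw, e⟩ := h
  have hp1 : IsWeakDeriv u (p.1 1 : Lp ℝ 2 (volume : Measure ℝ)) := (p.2 0).congr hp.symm .rfl
  -- The elliptic equation does not say that its `v` is in `L²`; uniqueness of weak derivatives
  -- identifies it with the one stored in `H¹`.
  have hvL : MemLp v 2 volume := (Lp.memLp (p.1 1)).ae_eq (hp1.unique hv)
  have hu : MemLp u 2 volume := (Lp.memLp (p.1 0)).ae_eq hp.symm
  obtain ⟨C, hC⟩ := exists_rpow_sub_bound k K hε hε1 n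
  have hn := hC φ (fun _ => 1) K hφ (by simpa using SobBound.zero_fun) hle
    (.of_forall fun _ => hε1) hφ
  simp only [Real.one_rpow] at hn
  have hnv : MemLp (fun x => φ x ^ n * v x) 2 volume := by
    have hvB : SobBound 0 v (eLpNorm v 2 volume).toNNReal :=
      ⟨hvL.1, by rw [ENNReal.coe_toNNReal hvL.eLpNorm_ne_top]⟩
    refine (((hn.of_le (j := 1) (by omega)).mul_of_succ hvB).add hvB).memLp.ae_eq
      (.of_forall fun x => ?_)
    ring
  refine ⟨fun x => φ x ^ n * v x - (φ x ^ n - 1), hu, hnv.sub hn.memLp, hv.congr .rfl ?_, ?_⟩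
  · filter_upwards [hle] with x hx
    have h0 : φ x ^ n ≠ 0 := (Real.rpow_pos_of_pos (hε.trans_le hx) n).ne'
    rw [Real.rpow_neg (hε.trans_le hx).le]
    field_simp
    ring
  · refine (hw.sub (hg.sub (isWeakDeriv_const 1))).congr .rfl ?_
    filter_upwards [e] with x hx
    simp only [Pi.zero_apply, sub_zero]
    linarith

/-- The map `φ ↦ φ^m L_φ⁻¹[-(φ^n)_z]` is Lipschitz on bounded subsets of `1 + H^{k+1}` that are
bounded away from zero. -/
theorem exists_flux_lipschitz (n m : ℝ) (k : ℕ) (K : ℝ≥0) {ε : ℝ} (hε : 0 < ε) (hε1 : ε ≤ 1) :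
    ∃ C : ℝ≥0, ∀ (φ ψ u v : ℝ → ℝ) (B : ℝ≥0), SobBound (k + 1) (fun x => φ x - 1) K →
      SobBound (k + 1) (fun x => ψ x - 1) K → (∀ᵐ x, ε ≤ φ x) → (∀ᵐ x, ε ≤ ψ x) →
      IsVelocity n m φ u → IsVelocity n m ψ v → SobBound (k + 1) (fun x => φ x - ψ x) B →
      SobBound (k + 1) (fun x => φ x ^ m * u x - ψ x ^ m * v x) (C * B) := by
  obtain ⟨Ca, hCa⟩ := exists_rpow_sub_bound k K hε hε1 (-n)
  obtain ⟨Cc, hCc⟩ := exists_rpow_sub_bound k K hε hε1 m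
  obtain ⟨δa, ha0, ha⟩ := exists_rpow_lower_bound hε (1 + 2 * K) (-n)
  obtain ⟨δc, hc0, hc⟩ := exists_rpow_lower_bound hε (1 + 2 * K) m
  set K' := max (Ca * K) (Cc * K)
  obtain ⟨Cs, hCs⟩ := exists_system_bound k K' (lt_min ha0 hc0)
  -- `U` bounds each pair `(u, y)`, whose forcing `(1 - φ^{-n}, 0)` has size `K'`; `F * B` will
  -- bound the forcing of the difference system.
  set U := Cs * K'
  set F := 2 ^ (k + 2) * Ca * U + Ca + 2 ^ (k + 2) * Cc * U
  have coeff : ∀ {φ : ℝ → ℝ}, SobBound (k + 1) (fun x => φ x - 1) K → (∀ᵐ x, ε ≤ φ x) →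
      SobBound (k + 1) (fun x => φ x ^ (-n) - 1) K' ∧
      SobBound (k + 1) (fun x => φ x ^ m - 1) K' ∧
      (∀ᵐ x, (min δa δc : ℝ≥0) ≤ φ x ^ (-n)) ∧ (∀ᵐ x, (min δa δc : ℝ≥0) ≤ φ x ^ m) := by
    intro φ hφ e
    have h1 := hCa φ (fun _ => 1) K hφ (by simpa using SobBound.zero_fun) e
      (.of_forall fun _ => hε1) hφ
    have h2 := hCc φ (fun _ => 1) K hφ (by simpa using SobBound.zero_fun) e
      (.of_forall fun _ => hε1) hφ
    simp only [Real.one_rpow] at h1 h2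
    refine ⟨h1.mono (le_max_left _ _), h2.mono (le_max_right _ _), ?_, ?_⟩
    · filter_upwards [hφ.ae_mem_Icc e] with x hx
      exact le_trans (by exact_mod_cast min_le_left _ _) (ha _ hx)
    · filter_upwards [hφ.ae_mem_Icc e] with x hx
      exact le_trans (by exact_mod_cast min_le_right _ _) (hc _ hx)
  refine ⟨2 ^ (k + 2) * Cc * U + 2 ^ (k + 2) * K' * (Cs * F) + Cs * F,
    fun φ ψ u v B hφ hψ e1 e2 hu hv hB => ?_⟩
  obtain ⟨y, mu, my, wu, wy⟩ := hu.exists_system hε hε1 hφ e1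
  obtain ⟨z, mv, mz, wv, wz⟩ := hv.exists_system hε hε1 hψ e2
  obtain ⟨a1, c1, da1, dc1⟩ := coeff hφ e1
  obtain ⟨a2, c2, da2, dc2⟩ := coeff hψ e2
  obtain ⟨bu, bY⟩ := hCs (fun x => φ x ^ (-n)) (fun x => φ x ^ m) (fun x => 1 - φ x ^ (-n))
    (fun _ => 0) u y K' a1 c1 da1 dc1 (by simpa using a1.neg) SobBound.zero_fun mu my wu
    (by simpa using wy)
  have da := hCa φ ψ B hφ hψ e1 e2 hB
  have dc := hCc φ ψ B hφ hψ e1 e2 hB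
  have bf := ((da.mul bY).sub da).mono (B := F * B) (by
    calc _ = (2 ^ (k + 2) * Ca * U + Ca) * B := by ring
      _ ≤ _ := by gcongr ?_ * _; exact le_self_add)
  have bg := (dc.mul bu).mono (B := F * B) (by
    calc _ = (2 ^ (k + 2) * Cc * U) * B := by ring
      _ ≤ _ := by gcongr ?_ * _; exact le_add_self)
  -- The differences satisfy the system with the coefficients of `ψ` and forcing `(φ^{-n} - ψ^{-n})
  -- y - (φ^{-n} - ψ^{-n})`, `(φ^m - ψ^m) u`.
  obtain ⟨bd, -⟩ := hCs (fun x => ψ x ^ (-n)) (fun x => ψ x ^ m) _ _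
    (fun x => u x - v x) (fun x => y x - z x) (F * B) a2 c2 da2 dc2 bf bg (mu.sub mv)
    (my.sub mz) ((wu.sub wv).congr .rfl (.of_forall fun x => by ring))
    ((wy.sub wz).congr .rfl (.of_forall fun x => by ring))
  -- `φ^m u - ψ^m v = (φ^m - ψ^m) u + (ψ^m - 1)(u - v) + (u - v)`.
  refine ((((dc.mul bu).add (c2.mul bd)).add bd).mono (le_of_eq ?_)).congr
    (.of_forall fun x => ?_)
  · ring
  · ring

/-! ### Comparison of the `H^k` norm with Sobolev bounds -/

theorem toFn_sub {k : ℕ} (p q : Hk k) :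
    toFn (p - q) =ᵐ[volume] fun z => toFn p z - toFn q z :=
  Lp.coeFn_sub (p.1 0) (q.1 0)

theorem sobBound_coord {k : ℕ} (p : Hk k) (i j : ℕ) (h : i + j = k) :
    SobBound i (p.1 ⟨j, by omega⟩ : L2) ‖p‖₊ := by
  have z : ∀ l, SobBound 0 (p.1 l : L2) ‖p‖₊ := fun l => by
    refine ⟨Lp.aestronglyMeasurable _, ?_⟩
    rw [← Lp.enorm_def]
    have : ‖p.1 l‖₊ ≤ ‖p‖₊ := PiLp.nnnorm_apply_le p.1 l
    exact_mod_cast this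
  induction i generalizing j with
  | zero => exact z _
  | succ i ih => exact (z _).succ (p.2 ⟨j, by omega⟩) (ih (j + 1) (by omega))

theorem sobBound_toFn {k : ℕ} (p : Hk k) : SobBound k (toFn p) ‖p‖₊ :=
  sobBound_coord p k 0 rfl

theorem nnnorm_coord_le {k : ℕ} (p : Hk k) {B : ℝ≥0} (i j : ℕ) (h : i + j = k)
    (hB : SobBound i (p.1 ⟨j, by omega⟩ : L2) B) (l : Fin (k + 1)) (hl : j ≤ l) :
    ‖p.1 l‖₊ ≤ B := by
  induction i generalizing j with
  | zero =>
    have : l = ⟨j, by omega⟩ := Fin.ext (by have := l.2; simp; omega)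
    rw [this]
    have h2 := hB.2
    rw [← Lp.enorm_def] at h2
    exact_mod_cast h2
  | succ i ih =>
    rcases hl.eq_or_lt with hl | hl
    · have : l = ⟨j, by omega⟩ := Fin.ext hl.symm
      rw [this]
      have h2 := hB.zero_order.2
      rw [← Lp.enorm_def] at h2
      exact_mod_cast h2
    · exact ih (j + 1) (by omega) (hB.of_weakDeriv (p.2 ⟨j, by omega⟩)) hl

/-- Each of the `k + 1` coordinates is at most `B`; the factor `k + 1` crudely replaces its square
root. -/
theorem nnnorm_le_of_sobBound {k : ℕ} (p : Hk k) {B : ℝ≥0} (hB : SobBound k (toFn p) B) :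
    ‖p‖₊ ≤ (k + 1) * B := by
  have h : ∀ l, ‖p.1 l‖₊ ≤ B := fun l => nnnorm_coord_le p k 0 rfl hB l (Nat.zero_le _)
  have h2 : ‖p.1‖ ^ 2 ≤ ((k + 1) * B : ℝ) ^ 2 := by
    rw [PiLp.norm_sq_eq_of_L2]
    calc ∑ l, ‖p.1 l‖ ^ 2 ≤ ∑ _l : Fin (k + 1), (B : ℝ) ^ 2 := by
          gcongr with l; exact h l
      _ = (k + 1) * (B : ℝ) ^ 2 := by simp
      _ ≤ _ := by
        rw [mul_pow]
        gcongr
        nlinarith [(Nat.cast_nonneg k : (0 : ℝ) ≤ k)]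
  have h3 := le_of_sq_le_sq h2 (by positivity)
  exact_mod_cast h3

theorem eq_of_toFn_ae_eq {k : ℕ} {p q : Hk k} (h : toFn p =ᵐ[volume] toFn q) : p = q := by
  have h1 : SobBound k (toFn (p - q)) 0 := SobBound.zero_fun.congr (by
    filter_upwards [toFn_sub p q, h] with z h1 h2
    rw [h1, h2, sub_self])
  have h2 := nnnorm_le_of_sobBound _ h1
  rw [mul_zero, nonpos_iff_eq_zero, nnnorm_eq_zero] at h2
  exact sub_eq_zero.1 h2

/-- The infimum runs over a single element, since a function determines its weak derivatives. -/
theorem hkNorm_eq {k : ℕ} {f : ℝ → ℝ} {p : Hk k} (h : f =ᵐ[volume] toFn p) :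
    hkNorm k f = ‖p‖ₑ := by
  refine le_antisymm (iInf₂_le p h) (le_iInf₂ fun q hq => ?_)
  rw [eq_of_toFn_ae_eq (h.symm.trans hq)]

theorem ae_le_of_invSupNorm_le {f : ℝ → ℝ} {ε : ℝ} (hε : 0 < ε)
    (h : invSupNorm f ≤ ENNReal.ofReal ε⁻¹) (hpos : ∀ᵐ z, 0 < f z) : ∀ᵐ z, ε ≤ f z := by
  filter_upwards [ENNReal.ae_le_essSup (μ := volume) (fun z => ‖f z‖ₑ⁻¹), hpos] with z h1 h2
  have h3 := h1.trans h
  rw [ENNReal.ofReal_inv_of_pos hε, ENNReal.inv_le_inv, Real.enorm_of_nonneg h2.le] at h3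
  exact (ENNReal.ofReal_le_ofReal_iff h2.le).1 h3

/-! ### Evolution equation in differential form and Grönwall's inequality -/

/-- The underlying `L²` function, as a continuous linear map on `H^k(ℝ)`. -/
def toL2 (k : ℕ) : Hk k →L[ℝ] L2 :=
  (PiLp.proj 2 (fun _ : Fin (k + 1) => L2) 0).comp (Hk k).subtypeL

/-- The differential form of the integrated evolution equation. -/
theorem IsLocalSolution.ae_exists_velocity {n m T : ℝ} {k : ℕ} {φ₀ : ℝ → ℝ} {φ : ℝ → ℝ → ℝ}
    (h : IsLocalSolution n m k T φ₀ φ) {p : ℝ → Hk k}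
    (hp : ContDiffOn ℝ 1 p (Icc 0 T))
    (hφ : ∀ t ∈ Icc 0 T, (fun z => φ t z - 1) =ᵐ[volume] toFn (p t)) :
    ∀ᵐ t, t ∈ Ioo 0 T → ∃ u, IsVelocity n m (φ t) u ∧
      toFn (derivWithin p (Icc 0 T) t) =ᵐ[volume] fun z => φ t z ^ m * u z := by
  obtain ⟨u, q, hu, hq, hqi, hΛ⟩ := h.fixed
  -- `q` is merely integrable in time, so its integral is differentiated only at almost every `t`.
  filter_upwards [hqi.ae_hasDerivAt_integral] with t ht htT
  have hT : 0 ≤ T := (htT.1.trans htT.2).le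
  have h0 : (0 : ℝ) ∈ Icc 0 T := ⟨le_rfl, hT⟩
  have htI := Ioo_subset_Icc_self htT
  have hn : Icc 0 T ∈ 𝓝 t := Icc_mem_nhds htT.1 htT.2
  have key : ∀ s ∈ Icc 0 T, toL2 k (p s) = toL2 k (p 0) + ∫ x in (0 : ℝ)..s, q x := by
    intro s hs
    refine Lp.ext ?_
    have e0 := hΛ 0 h0
    rw [intervalIntegral.integral_same] at e0
    filter_upwards [hφ s hs, hφ 0 h0, hΛ s hs, e0, Lp.coeFn_zero ℝ 2 (volume : Measure ℝ),
      Lp.coeFn_add (toL2 k (p 0)) (∫ x in (0 : ℝ)..s, q x)] with z a1 a2 a3 a4 a5 a6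
    rw [a6, Pi.add_apply]
    change toFn (p s) z = toFn (p 0) z + _
    rw [← a1, ← a2, a3, a4, a5]
    simp only [Pi.zero_apply]
    ring
  have d1 : HasDerivAt (fun s => toL2 k (p s)) (toL2 k (derivWithin p (Icc 0 T) t)) t := by
    have := ((hp.differentiableOn one_ne_zero t htI).hasDerivWithinAt).hasDerivAt hn
    exact (toL2 k).hasFDerivAt.comp_hasDerivAt t this
  have d2 : HasDerivAt (fun s => toL2 k (p s)) (q t) t := by
    have := (ht (by rwa [uIcc_of_le hT]) 0 (by rwa [uIcc_of_le hT])).const_add (toL2 k (p 0))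
    refine this.congr_of_eventuallyEq ?_
    filter_upwards [hn] with s hs using key s hs
  refine ⟨u t, hu t htI, ?_⟩
  have e : toL2 k (derivWithin p (Icc 0 T) t) = q t := d1.unique d2
  have e' : toFn (derivWithin p (Icc 0 T) t) = (q t : ℝ → ℝ) := by rw [← e]; rfl
  rw [e']
  exact hq t htI

/-- Both sides of the differential inequality are continuous in time for a `C¹` curve, so it extends
from almost every time to all of `[0, T]`, and Grönwall applies. -/
theorem norm_le_mul_exp_of_ae {E : Type*} [NormedAddCommGroup E] [NormedSpace ℝ E] {f : ℝ → E}
    {T K : ℝ} (hT : 0 < T) (hf : ContDiffOn ℝ 1 f (Icc 0 T))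
    (h : ∀ᵐ t, t ∈ Ioo 0 T → ‖derivWithin f (Icc 0 T) t‖ ≤ K * ‖f t‖) :
    ∀ t ∈ Icc 0 T, ‖f t‖ ≤ ‖f 0‖ * Real.exp (K * t) := by
  have hd := hf.continuousOn_derivWithin (uniqueDiffOn_Icc hT) le_rfl
  have hc := hf.continuousOn
  have hle : ∀ t ∈ Icc 0 T, ‖derivWithin f (Icc 0 T) t‖ ≤ K * ‖f t‖ := by
    have := Measure.eqOn_Icc_of_ae_eq volume hT.ne
      (f := fun t => max ‖derivWithin f (Icc 0 T) t‖ (K * ‖f t‖)) (g := fun t => K * ‖f t‖)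
      (by
        rw [← Measure.restrict_congr_set Ioo_ae_eq_Icc]
        refine (ae_restrict_iff' measurableSet_Ioo).2 ?_
        filter_upwards [h] with t ht htT using max_eq_right (ht htT))
      (hd.norm.sup (continuousOn_const.mul hc.norm)) (continuousOn_const.mul hc.norm)
    exact fun t ht => max_eq_right_iff.1 (this ht)
  intro t ht
  have := norm_le_gronwallBound_of_norm_deriv_right_le (δ := ‖f 0‖) (K := K) (ε := 0) hc
    (f' := derivWithin f (Icc 0 T)) (fun x hx =>
      ((hf.differentiableOn one_ne_zero x (Ico_subset_Icc_self hx)).hasDerivWithinAt).mono_of_mem_nhdsWithin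
        (Icc_mem_nhdsGE_of_mem hx)) le_rfl
    (fun x hx => by simpa using hle x (Ico_subset_Icc_self hx)) t ht
  simpa [gronwallBound_ε0] using this

end Magma

end

/-! ### Continuous dependence on the data -/

theorem mainTheorem2 (n m : ℝ) (k : ℕ) (hk : 1 ≤ k) (R ε : ℝ) (hR : 0 < R) (hε : 0 < ε)
    (hε1 : ε ≤ 1) :
    ∃ C : ℝ, ∀ (T : ℝ) (φ₀ ψ₀ : ℝ → ℝ) (φ ψ : ℝ → ℝ → ℝ), 0 < T →
      Magma.hkNorm k (fun z => φ₀ z - 1) < ENNReal.ofReal R →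
      Magma.invSupNorm φ₀ ≤ ENNReal.ofReal (2 * ε)⁻¹ →
      Magma.hkNorm k (fun z => ψ₀ z - 1) < ENNReal.ofReal R →
      Magma.invSupNorm ψ₀ ≤ ENNReal.ofReal (2 * ε)⁻¹ →
      φ ∈ Magma.X k R ε T → Magma.IsLocalSolution n m k T φ₀ φ →
      ψ ∈ Magma.X k R ε T → Magma.IsLocalSolution n m k T ψ₀ ψ →
      ∀ t ∈ Set.Ico 0 T,
        Magma.hkNorm k (fun z => φ t z - ψ t z) ≤
          Magma.hkNorm k (fun z => φ₀ z - ψ₀ z) * ENNReal.ofReal (Real.exp (C * t)) := by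
  obtain ⟨k, rfl⟩ : ∃ j, k = j + 1 := ⟨k - 1, by omega⟩
  obtain ⟨C, hC⟩ := Magma.exists_flux_lipschitz n m k R.toNNReal hε hε1
  -- `C` is the Lipschitz constant of the flux in terms of Sobolev bounds; the other factor converts
  -- such a bound into the norm of `H^{k+1}`.
  refine ⟨((k + 1 : ℕ) + 1) * C, fun T φ₀ ψ₀ φ ψ hT _ _ _ _ hφX hφ hψX hψ => ?_⟩
  have bounds : ∀ {φ₀ : ℝ → ℝ} {φ : ℝ → ℝ → ℝ} {p : ℝ → Magma.Hk (k + 1)},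
      φ ∈ Magma.X (k + 1) R ε T → Magma.IsLocalSolution n m (k + 1) T φ₀ φ →
      (∀ t ∈ Set.Icc 0 T, (fun z => φ t z - 1) =ᵐ[MeasureTheory.volume] Magma.toFn (p t)) →
      (∀ t ∈ Set.Ico 0 T, Magma.SobBound (k + 1) (fun z => φ t z - 1) R.toNNReal ∧
        ∀ᵐ z, ε ≤ φ t z) ∧ φ 0 =ᵐ[MeasureTheory.volume] φ₀ := by
    intro φ₀ φ p hX hφ hp
    refine ⟨fun t ht => ⟨?_, ?_⟩, ?_⟩
    · have e := hp t (Set.Ico_subset_Icc_self ht)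
      have h1 := (le_iSup₂ (f := fun t (_ : t ∈ Set.Ico 0 T) =>
        Magma.hkNorm (k + 1) (fun z => φ t z - 1)) t ht).trans hX.2.1
      rw [Magma.hkNorm_eq e] at h1
      exact ((Magma.sobBound_toFn (p t)).mono (ENNReal.coe_le_coe.1 h1)).congr e.symm
    · exact Magma.ae_le_of_invSupNorm_le hε ((le_iSup₂ (f := fun t (_ : t ∈ Set.Ico 0 T) =>
        Magma.invSupNorm (φ t)) t ht).trans hX.2.2) (hφ.pos t (Set.Ico_subset_Icc_self ht))
    · obtain ⟨u, q, -, -, -, hΛ⟩ := hφ.fixed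
      have h0 := hΛ 0 ⟨le_rfl, hT.le⟩
      rw [intervalIntegral.integral_same] at h0
      filter_upwards [h0, MeasureTheory.Lp.coeFn_zero ℝ 2 (MeasureTheory.volume)] with z h1 h2
      rw [h1, h2, Pi.zero_apply, add_zero]
  obtain ⟨p, hp, hpφ⟩ := hφX.1
  obtain ⟨r, hr, hrψ⟩ := hψX.1
  obtain ⟨b1, i1⟩ := bounds hφX hφ hpφ
  obtain ⟨b2, i2⟩ := bounds hψX hψ hrψ
  have hdiff : ∀ t ∈ Set.Icc 0 T, (fun z => φ t z - ψ t z) =ᵐ[MeasureTheory.volume]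
      Magma.toFn (p t - r t) := by
    intro t ht
    filter_upwards [hpφ t ht, hrψ t ht, Magma.toFn_sub (p t) (r t)] with z h1 h2 h3
    rw [h3, ← h1, ← h2]
    ring
  have hgr := Magma.norm_le_mul_exp_of_ae (f := fun t => p t - r t)
    (K := ((k + 1 : ℕ) + 1) * C) hT (hp.sub hr) (by
      filter_upwards [hφ.ae_exists_velocity hp hpφ, hψ.ae_exists_velocity hr hrψ] with t h1 h2 ht
      obtain ⟨u, hu, eu⟩ := h1 ht
      obtain ⟨v, hv, ev⟩ := h2 ht
      have htI := Set.Ioo_subset_Icc_self ht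
      have htJ := Set.Ioo_subset_Ico_self ht
      have hb := hC (φ t) (ψ t) u v ‖p t - r t‖₊ (b1 t htJ).1 (b2 t htJ).1 (b1 t htJ).2
        (b2 t htJ).2 hu hv ((Magma.sobBound_toFn _).congr (hdiff t htI).symm)
      rw [derivWithin_fun_sub (hp.differentiableOn one_ne_zero t htI)
        (hr.differentiableOn one_ne_zero t htI)]
      have := Magma.nnnorm_le_of_sobBound (derivWithin p (Set.Icc 0 T) t -
        derivWithin r (Set.Icc 0 T) t) (hb.congr (by
          filter_upwards [Magma.toFn_sub (derivWithin p (Set.Icc 0 T) t)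
            (derivWithin r (Set.Icc 0 T) t), eu, ev] with z a1 a2 a3
          rw [a1, a2, a3]))
      rw [mul_assoc]
      exact_mod_cast this)
  intro t ht
  have htI := Set.Ico_subset_Icc_self ht
  have h0 : (fun z => φ₀ z - ψ₀ z) =ᵐ[MeasureTheory.volume] Magma.toFn (p 0 - r 0) := by
    filter_upwards [hdiff 0 ⟨le_rfl, hT.le⟩, i1, i2] with z a1 a2 a3
    rw [← a1, a2, a3]
  rw [Magma.hkNorm_eq (hdiff t htI), Magma.hkNorm_eq h0, ← ofReal_norm, ← ofReal_norm,
    ← ENNReal.ofReal_mul (norm_nonneg _)]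
  exact ENNReal.ofReal_le_ofReal (hgr t htI)
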